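/- A plane increasing binary tree of size $n\ge 1$ is a non-empty binary tree with $n$ nodes, in which left and right children are distinguished and each of them may be missing, whose nodes carry the labels $1,\dots,n$, each exactly once, such that the labels increase along every path that leads away from the root. A fringe subtree of a tree consists of a node together with all its descendants, and its shape is the unlabelled plane binary tree that is left when the labels are forgotten. Let $T(z)=\sum_{n\ge1}T_n\frac{z^n}{n!}$ be the exponential generating function of plane increasing binary trees. For an unlabelled plane binary tree $t$ with $|t|\ge 1$ nodes let $S_t(z)$ be the exponential generating function of those plane increasing binary trees in which no fringe subtree has shape $t$. Let $\mathcal{B}_{\le n}$ be the set of unlabelled plane binary trees $t$ with $1\le|t|\le n$. **Proposition.** As $n\to\infty$, $$\sum_{\substack{t\in\mathcal{B}_{\le n}\\ |t|\ge\log_4 n}}\left(1-\frac{[z^n]S_t(z)}{[z^n]T(z)}\right)=\Omega(\sqrt n).$$ Equivalently, if $\tau_n$ is a uniformly random plane increasing binary tree of size $n$, then $$\sum_{\substack{t\in\mathcal{B}_{\le n}\\ |t|\ge\log_4 n}}\mathbb{P}\left(t\text{ occurs as the shape of a fringe subtree of }\tau_n\right)=\Omega(\sqrt n).$$ Hence,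 if $X_n$ denotes the size of the compacted tree of $\tau_n$, that is, the number of distinct shapes of fringe subtrees of $\tau_n$, then $\mathbb{E}(X_n)=\Omega(\sqrt n)$. Here $f(n)=\Omega(\sqrt n)$ means that there are a constant $c>0$ and an $N$ such that $f(n)\ge c\sqrt n$ for all $n\ge N$. -/

import Mathlib

open Filter

namespace IncBinTree

/-- The multiset of the labels of a plane binary tree. -/
def labels {α : Type*} : BinaryTree α → Multiset α
  | .nil => 0
  | .node a l r => a ::ₘ (labels l + labels r)

/-- The label of every node is smaller than the labels of all its proper descendants, i.e. the
labels increase along every path that leads away from the root. -/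
def Increasing {α : Type*} [LT α] : BinaryTree α → Prop
  | .nil => True
  | .node a l r =>
      (∀ b ∈ labels l, a < b) ∧ (∀ b ∈ labels r, a < b) ∧ Increasing l ∧ Increasing r

/-- The plane increasing binary trees of size `n`: non-empty plane binary trees (left and right
children are distinguished, each may be missing) with `n` nodes that carry the labels `1, …, n`,
each of them once, increasingly. -/
def increasingTreeSet (n : ℕ) : Set (BinaryTree ℕ) :=
  {τ | τ ≠ .nil ∧ labels τ = (Finset.Icc 1 n).val ∧ Increasing τ}

theorem finite_of_labels (s : Finset ℕ) (m : ℕ) :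
    {τ : BinaryTree ℕ | τ.numNodes ≤ m ∧ ∀ a ∈ labels τ, a ∈ s}.Finite := by
  induction m with
  | zero =>
    refine (Set.finite_singleton BinaryTree.nil).subset ?_
    rintro (_ | ⟨a, l, r⟩) ⟨h, -⟩
    · rfl
    · simp at h
  | succ m ih =>
    refine ((Set.finite_singleton BinaryTree.nil).union
      (((s.finite_toSet.prod (ih.prod ih))).image
        fun p => BinaryTree.node p.1 p.2.1 p.2.2)).subset ?_
    rintro (_ | ⟨a, l, r⟩) ⟨h, hs⟩
    · exact Or.inl rfl
    · right
      simp only [BinaryTree.numNodes] at h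
      simp only [labels, Multiset.mem_cons, Multiset.mem_add] at hs
      have h₁ : l.numNodes ≤ m := by omega
      have h₂ : r.numNodes ≤ m := by omega
      exact ⟨(a, l, r), ⟨hs a (Or.inl rfl), ⟨h₁, fun b hb => hs b (Or.inr (Or.inl hb))⟩,
        ⟨h₂, fun b hb => hs b (Or.inr (Or.inr hb))⟩⟩, rfl⟩

theorem card_labels {α : Type*} (τ : BinaryTree α) : (labels τ).card = τ.numNodes := by
  induction τ with
  | nil => rfl
  | node a l r hl hr => simp [labels, hl, hr]

theorem finite_increasingTreeSet (n : ℕ) : (increasingTreeSet n).Finite := by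
  refine (finite_of_labels (Finset.Icc 1 n) n).subset ?_
  rintro τ ⟨-, h, -⟩
  refine ⟨?_, fun a ha => ?_⟩
  · rw [← card_labels, h]; simp
  · rw [h] at ha; exact ha

/-- The finite set of all plane increasing binary trees of size `n`. -/
noncomputable def increasingTrees (n : ℕ) : Finset (BinaryTree ℕ) :=
  (finite_increasingTreeSet n).toFinset

/-- The shape of a labelled tree: the labels are forgotten. -/
def shape {α : Type*} (τ : BinaryTree α) : BinaryTree Unit := τ.map fun _ => ()

/-- The fringe subtrees of a tree (a node together with all its descendants), one for each node. -/
def fringeSubtrees {α : Type*} : BinaryTree α → List (BinaryTree α)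
  | .nil => []
  | .node a l r => .node a l r :: (fringeSubtrees l ++ fringeSubtrees r)

/-- The set of the distinct shapes of the fringe subtrees. -/
def fringeShapes {α : Type*} (τ : BinaryTree α) : Finset (BinaryTree Unit) :=
  ((fringeSubtrees τ).map shape).toFinset

/-- The size of the compacted tree: only one occurrence of each fringe subtree shape is kept. -/
def compactedSize {α : Type*} (τ : BinaryTree α) : ℕ := (fringeShapes τ).card

/-- The unlabelled plane binary trees (tree shapes) of size at least `1` and at most `n`. -/
def shapesUpTo (n : ℕ) : Finset (BinaryTree Unit) :=
  (Finset.Icc 1 n).biUnion BinaryTree.treesOfNumNodesEq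

/-- The shapes `t` of size at most `n` with `|t| ≥ log₄ n`. -/
noncomputable def largeShapes (n : ℕ) : Finset (BinaryTree Unit) :=
  (shapesUpTo n).filter fun t => Real.logb 4 n ≤ (t.numNodes : ℝ)

/-- The exponential generating function `T(z)` of plane increasing binary trees. -/
noncomputable def egfT : PowerSeries ℝ :=
  PowerSeries.mk fun n => ((increasingTrees n).card : ℝ) / n.factorial

/-- The exponential generating function `S_t(z)` of the plane increasing binary trees that do not
contain the shape `t` as a fringe subtree. -/
noncomputable def egfS (t : BinaryTree Unit) : PowerSeries ℝ :=
  PowerSeries.mk fun n =>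
    (((increasingTrees n).filter fun τ => t ∉ fringeShapes τ).card : ℝ) / n.factorial

/-- The probability that the shape `t` occurs as the shape of a fringe subtree of a uniformly
random plane increasing binary tree of size `n`. -/
noncomputable def occurrenceProb (n : ℕ) (t : BinaryTree Unit) : ℝ :=
  (((increasingTrees n).filter fun τ => t ∈ fringeShapes τ).card : ℝ) / (increasingTrees n).card

/-- The expected size of the compacted tree of a uniformly random plane increasing binary tree of
size `n`. -/
noncomputable def expectedCompactedSize (n : ℕ) : ℝ :=
  (∑ τ ∈ increasingTrees n, (compactedSize τ : ℝ)) / (increasingTrees n).card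

end IncBinTree

/-!
In a random increasing tree with `n + 1` nodes the size of the left subtree is uniform on
`{0, …, n}`, and given the sizes the two subtrees are independent. Hence a shape `t` with `k` nodes
has probability `p`, the product of the reciprocals of its fringe subtree sizes, among the trees of
size `k`, and for `n > k` it occurs `m = 2 p (n + 1) / ((k + 1) (k + 2))` times in the mean.
The probability that `t` occurs is at most `m`, and at least `m` minus the expected number of pairs
of occurrences, which is at most about `(p n / k)² / 2`. Since `p` is exponentially small in `k`,
we have `p (n + 2) ≤ 1` as soon as `k` exceeds a constant multiple of `log n`, and then the pairs
cost at most half of `m`. The probabilities `p` of all shapes of size `k` add up to `1`, so these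
shapes contribute at least `(n + 1) / ((k + 1) (k + 2))`; the sum over `C log n ≤ k ≤ n` telescopes
to order `n / log n`, which dominates `√n`.
-/

namespace IncBinTree

open BinaryTree Finset
open scoped Nat

section Shapes

variable {α : Type*} {t u : BinaryTree Unit} {τ : BinaryTree α}

theorem shape_node (a : α) (l r : BinaryTree α) : shape (.node a l r) = shape l △ shape r := rfl

theorem shape_eq_nil : shape τ = .nil ↔ τ = .nil := by
  cases τ <;> simp [shape, BinaryTree.map]

theorem shape_unit (u : BinaryTree Unit) : shape u = u :=
  BinaryTree.id_map u

@[simp]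
theorem numNodes_shape (τ : BinaryTree α) : (shape τ).numNodes = τ.numNodes := by
  induction τ with
  | nil => rfl
  | node a l r hl hr => simp [shape_node, hl, hr]

@[simp]
theorem fringeShapes_nil : fringeShapes (.nil : BinaryTree α) = ∅ := rfl

theorem mem_fringeShapes_node {a : α} {l r : BinaryTree α} :
    t ∈ fringeShapes (.node a l r) ↔
      t = shape l △ shape r ∨ t ∈ fringeShapes l ∨ t ∈ fringeShapes r := by
  simp [fringeShapes, fringeSubtrees, shape_node, eq_comm]

theorem fringeShapes_shape (τ : BinaryTree α) : fringeShapes (shape τ) = fringeShapes τ := by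
  induction τ with
  | nil => rfl
  | node a l r hl hr =>
    ext t
    rw [shape_node, mem_fringeShapes_node, mem_fringeShapes_node, hl, hr, shape_unit, shape_unit]

theorem numNodes_pos_of_mem_fringeShapes (h : t ∈ fringeShapes τ) : 0 < t.numNodes := by
  induction τ with
  | nil => simp at h
  | node a l r hl hr =>
    rcases mem_fringeShapes_node.1 h with rfl | h | h
    · simp
    · exact hl h
    · exact hr h

theorem numNodes_le_of_mem_fringeShapes (h : t ∈ fringeShapes τ) : t.numNodes ≤ τ.numNodes := by
  induction τ with
  | nil => simp at h
  | node a l r hl hr =>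
    rw [numNodes]
    rcases mem_fringeShapes_node.1 h with rfl | h | h
    · simp
    · linarith [hl h]
    · linarith [hr h]

theorem mem_fringeShapes_iff_eq (hu : u ≠ .nil) (h : u.numNodes ≤ t.numNodes) :
    t ∈ fringeShapes u ↔ t = u := by
  obtain _ | ⟨⟨⟩, l, r⟩ := u
  · exact absurd rfl hu
  have not_mem_child {v : BinaryTree Unit} (hv : v.numNodes < t.numNodes) :
      t ∉ fringeShapes v :=
    fun hm => hv.not_ge (numNodes_le_of_mem_fringeShapes hm)
  rw [numNodes] at h
  rw [mem_fringeShapes_node, shape_unit, shape_unit,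
    or_iff_left (not_or.2 ⟨not_mem_child (by omega), not_mem_child (by omega)⟩)]

theorem mem_shapesUpTo {n : ℕ} : t ∈ shapesUpTo n ↔ 1 ≤ t.numNodes ∧ t.numNodes ≤ n := by
  simp [shapesUpTo]

end Shapes

theorem add_eq_val_iff_exists_subset {α : Type*} [DecidableEq α] {s : Finset α}
    {M N : Multiset α} :
    M + N = s.val ↔ ∃ A ⊆ s, M = A.val ∧ N = (s \ A).val := by
  constructor
  · intro h
    have hM : M.Nodup := Multiset.nodup_of_le (Multiset.le_add_right M N) (h ▸ s.nodup)
    refine ⟨⟨M, hM⟩, ?_, rfl, ?_⟩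
    · exact Finset.val_le_iff.1 (h ▸ Multiset.le_add_right M N)
    · rw [Finset.sdiff_val, ← h, add_tsub_cancel_left]
  · rintro ⟨A, hA, rfl, rfl⟩
    rw [Finset.sdiff_val, add_tsub_cancel_of_le (Finset.val_le_iff.2 hA)]

section IncreasingLabellings

variable {α : Type*} [LinearOrder α]

theorem labels_node_eq_and_increasing_iff {s : Finset α} (hs : s.Nonempty) {a : α}
    {x y : BinaryTree α} :
    labels (.node a x y) = s.val ∧ Increasing (.node a x y) ↔
      a = s.min' hs ∧ labels x + labels y = (s.erase (s.min' hs)).val ∧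
        Increasing x ∧ Increasing y := by
  constructor
  · rintro ⟨hlab, hax, hay, hx, hy⟩
    rw [labels] at hlab
    have hmem (b : α) : b ∈ s ↔ b = a ∨ b ∈ labels x ∨ b ∈ labels y := by
      rw [← Finset.mem_val, ← hlab, Multiset.mem_cons, Multiset.mem_add]
    have ha : s.min' hs = a := by
      refine (s.min'_eq_iff hs a).2 ⟨(hmem a).2 (Or.inl rfl), fun b hb => ?_⟩
      rcases (hmem b).1 hb with rfl | hb | hb
      · exact le_rfl
      · exact (hax b hb).le
      · exact (hay b hb).le
    exact ⟨ha.symm, by rw [ha, Finset.erase_val, ← hlab, Multiset.erase_cons_head], hx, hy⟩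
  · rintro ⟨rfl, hlab, hx, hy⟩
    have hlt : ∀ b ∈ labels x + labels y, s.min' hs < b := fun b hb =>
      s.min'_lt_of_mem_erase_min' hs (by rwa [hlab] at hb)
    refine ⟨?_, fun b hb => hlt b (Multiset.mem_add.2 (Or.inl hb)),
      fun b hb => hlt b (Multiset.mem_add.2 (Or.inr hb)), hx, hy⟩
    rw [labels, hlab, Finset.erase_val, Multiset.cons_erase (s.min'_mem hs)]

/-- The increasing trees of shape `u` with label set `s`. The root carries the least label, and `A`
runs through the possible label sets of the left subtree. -/
def increasingLabellings : BinaryTree Unit → Finset α → Finset (BinaryTree α)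
  | .nil, s => if s = ∅ then {.nil} else ∅
  | .node _ l r, s =>
      if hs : s.Nonempty then
        ((s.erase (s.min' hs)).powersetCard l.numNodes).biUnion fun A =>
          (increasingLabellings l A ×ˢ increasingLabellings r (s.erase (s.min' hs) \ A)).image
            fun p => .node (s.min' hs) p.1 p.2
      else ∅

theorem mem_increasingLabellings {u : BinaryTree Unit} {s : Finset α} {τ : BinaryTree α} :
    τ ∈ increasingLabellings u s ↔ labels τ = s.val ∧ Increasing τ ∧ shape τ = u := by
  induction u using BinaryTree.unitRecOn generalizing s τ with
  | base =>
    rw [shape_eq_nil, increasingLabellings]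
    constructor
    · split_ifs with hs
      · rintro hτ
        simp [Finset.mem_singleton.1 hτ, hs, labels, Increasing]
      · simp
    · rintro ⟨hlab, -, rfl⟩
      simp [Finset.val_eq_zero.1 hlab.symm]
  | ind l r hl hr =>
    rw [increasingLabellings]
    cases τ with
    | nil => split_ifs <;> simp [shape, BinaryTree.map]
    | node a x y =>
      split_ifs with hs
      · rw [← and_assoc, labels_node_eq_and_increasing_iff hs, add_eq_val_iff_exists_subset]
        simp only [mem_biUnion, mem_powersetCard, mem_image, mem_product, hl, hr, Prod.exists,
          shape_node, BinaryTree.node.injEq, true_and]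
        constructor
        · rintro ⟨A, ⟨hA, -⟩, _, _, ⟨⟨hx, hxi, hxs⟩, hy, hyi, hys⟩, rfl, rfl, rfl⟩
          exact ⟨⟨rfl, ⟨A, hA, hx, hy⟩, hxi, hyi⟩, hxs, hys⟩
        · rintro ⟨⟨rfl, ⟨A, hA, hx, hy⟩, hxi, hyi⟩, hxs, hys⟩
          have hcard : #A = l.numNodes := by
            rw [Finset.card_def, ← hx, card_labels, ← hxs, numNodes_shape]
          exact ⟨A, ⟨hA, hcard⟩, x, y, ⟨⟨hx, hxi, hxs⟩, hy, hyi, hys⟩, rfl, rfl, rfl⟩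
      · simp [Finset.not_nonempty_iff_eq_empty.1 hs, labels]

/-- The probability that a random increasing tree with as many nodes as `u` has shape `u`: the
product of the reciprocals of the sizes of the fringe subtrees of `u`. -/
noncomputable def shapeProb : BinaryTree Unit → ℝ
  | .nil => 1
  | .node _ l r => shapeProb l * shapeProb r / (l.numNodes + r.numNodes + 1)

theorem shapeProb_nonneg (u : BinaryTree Unit) : 0 ≤ shapeProb u := by
  induction u with
  | nil => exact zero_le_one
  | node a l r hl hr => rw [shapeProb]; positivity

theorem card_increasingLabellings_node {l r : BinaryTree Unit} {s : Finset α}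
    (hs : s.Nonempty) :
    #(increasingLabellings (l △ r) s) =
      ∑ A ∈ (s.erase (s.min' hs)).powersetCard l.numNodes,
        #(increasingLabellings l A) * #(increasingLabellings r (s.erase (s.min' hs) \ A)) := by
  rw [increasingLabellings, dif_pos hs, Finset.card_biUnion]
  · refine Finset.sum_congr rfl fun A _ => ?_
    rw [Finset.card_image_of_injective, Finset.card_product]
    rintro ⟨x, y⟩ ⟨x', y'⟩ h
    simpa using h
  · intro A _ B _ hAB
    refine Finset.disjoint_left.2 ?_
    intro τ hτA hτB
    simp only [mem_image, mem_product, mem_increasingLabellings, Prod.exists] at hτA hτB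
    obtain ⟨x, y, ⟨⟨hA, -⟩, -⟩, rfl⟩ := hτA
    obtain ⟨x', y', ⟨⟨hB, -⟩, -⟩, heq⟩ := hτB
    obtain ⟨-, rfl, -⟩ := BinaryTree.node.injEq .. ▸ heq
    exact hAB (Finset.val_injective (hA.symm.trans hB))

theorem card_increasingLabellings {u : BinaryTree Unit} {s : Finset α} (h : #s = u.numNodes) :
    (#(increasingLabellings u s) : ℝ) = u.numNodes ! * shapeProb u := by
  induction u using BinaryTree.unitRecOn generalizing s with
  | base =>
    rw [numNodes, Finset.card_eq_zero] at h
    simp [increasingLabellings, h, shapeProb]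
  | ind l r hl hr =>
    have hs : s.Nonempty := Finset.card_pos.1 (by rw [h, numNodes]; omega)
    set B := s.erase (s.min' hs) with hB
    have hcard : #B = l.numNodes + r.numNodes := by
      rw [hB, Finset.card_erase_of_mem (s.min'_mem hs), h, numNodes, Nat.add_sub_cancel]
    have hsplit : ∀ A ∈ B.powersetCard l.numNodes,
        (#(increasingLabellings l A) * #(increasingLabellings r (B \ A)) : ℝ) =
          (l.numNodes ! * shapeProb l) * (r.numNodes ! * shapeProb r) := by
      intro A hA
      obtain ⟨hAB, hAcard⟩ := mem_powersetCard.1 hA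
      rw [hl hAcard, hr (by rw [Finset.card_sdiff_of_subset hAB, hcard, hAcard]; omega)]
    rw [card_increasingLabellings_node hs, Nat.cast_sum]
    simp only [Nat.cast_mul]
    rw [Finset.sum_congr rfl hsplit, Finset.sum_const, Finset.card_powersetCard, hcard,
      nsmul_eq_mul, numNodes, shapeProb, Nat.factorial_succ,
      ← Nat.add_choose_mul_factorial_mul_factorial, Nat.choose_symm_add]
    push_cast
    field_simp

end IncreasingLabellings

section RandomShape

variable {n : ℕ} {t : BinaryTree Unit}

theorem mem_increasingTrees {τ : BinaryTree ℕ} :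
    τ ∈ increasingTrees n ↔ τ ≠ .nil ∧ labels τ = (Finset.Icc 1 n).val ∧ Increasing τ := by
  simp [increasingTrees, increasingTreeSet]

theorem numNodes_of_mem_increasingTrees {τ : BinaryTree ℕ} (h : τ ∈ increasingTrees n) :
    τ.numNodes = n := by
  rw [← card_labels, (mem_increasingTrees.1 h).2.1, Finset.card_val, Nat.card_Icc,
    Nat.add_sub_cancel]

theorem increasingTrees_zero : increasingTrees 0 = ∅ := by
  refine Finset.eq_empty_of_forall_notMem fun τ hτ => (mem_increasingTrees.1 hτ).1 ?_
  have hsize := numNodes_of_mem_increasingTrees hτ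
  cases τ with
  | nil => rfl
  | node a l r => simp at hsize

theorem card_filter_shape_increasingTrees (hn : n ≠ 0) (P : BinaryTree Unit → Prop)
    [DecidablePred P] :
    (#{τ ∈ increasingTrees n | P (shape τ)} : ℝ) =
      n ! * ∑ u ∈ treesOfNumNodesEq n with P u, shapeProb u := by
  rw [Finset.card_eq_sum_card_fiberwise (f := shape) (t := {u ∈ treesOfNumNodesEq n | P u}),
    Nat.cast_sum, Finset.mul_sum]
  · refine Finset.sum_congr rfl fun u hu => ?_
    rw [mem_filter, mem_treesOfNumNodesEq] at hu
    obtain ⟨rfl, hP⟩ := hu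
    rw [← card_increasingLabellings (s := Finset.Icc 1 u.numNodes) (by simp)]
    congr 2
    ext τ
    simp only [mem_filter, mem_increasingTrees, mem_increasingLabellings]
    constructor
    · rintro ⟨⟨⟨-, hlab, hinc⟩, -⟩, hshape⟩
      exact ⟨hlab, hinc, hshape⟩
    · rintro ⟨hlab, hinc, rfl⟩
      refine ⟨⟨⟨?_, hlab, hinc⟩, hP⟩, rfl⟩
      rintro rfl
      exact hn rfl
  · intro τ hτ
    obtain ⟨hτ, hP⟩ := Finset.mem_filter.1 hτ
    simpa [numNodes_of_mem_increasingTrees hτ] using hP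

theorem sum_treesOfNumNodesEq_succ {M : Type*} [AddCommMonoid M] (n : ℕ)
    (f : BinaryTree Unit → M) :
    ∑ u ∈ treesOfNumNodesEq (n + 1), f u =
      ∑ p ∈ antidiagonal n, ∑ l ∈ treesOfNumNodesEq p.1, ∑ r ∈ treesOfNumNodesEq p.2,
        f (l △ r) := by
  rw [treesOfNumNodesEq_succ, Finset.sum_biUnion]
  · refine Finset.sum_congr rfl fun p _ => ?_
    rw [Finset.sum_map, Finset.sum_product]
    rfl
  · intro p _ q _ hpq
    refine Finset.disjoint_left.2 fun u hp hq => hpq ?_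
    simp only [Finset.mem_map, mem_product, mem_treesOfNumNodesEq] at hp hq
    obtain ⟨⟨l, r⟩, ⟨hl, hr⟩, rfl⟩ := hp
    obtain ⟨⟨l', r'⟩, ⟨hl', hr'⟩, heq⟩ := hq
    obtain ⟨-, rfl, rfl⟩ := BinaryTree.node.injEq .. ▸ heq
    exact Prod.ext (hl.symm.trans hl') (hr.symm.trans hr')

/-- Given the size of the left subtree, which is uniformly distributed, the shapes of the two
subtrees are independent. -/
theorem add_one_mul_sum_shapeProb_mul_succ {f g h : BinaryTree Unit → ℝ}
    (hf : ∀ l r : BinaryTree Unit, l.numNodes + r.numNodes = n → f (l △ r) = g l * h r) :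
    (n + 1) * ∑ u ∈ treesOfNumNodesEq (n + 1), shapeProb u * f u =
      ∑ p ∈ antidiagonal n, (∑ l ∈ treesOfNumNodesEq p.1, shapeProb l * g l) *
        ∑ r ∈ treesOfNumNodesEq p.2, shapeProb r * h r := by
  rw [sum_treesOfNumNodesEq_succ, Finset.mul_sum]
  refine Finset.sum_congr rfl fun p hp => ?_
  rw [Finset.sum_mul_sum]
  simp only [Finset.mul_sum]
  refine Finset.sum_congr rfl fun l hl => Finset.sum_congr rfl fun r hr => ?_
  rw [mem_treesOfNumNodesEq] at hl hr
  have hsize : l.numNodes + r.numNodes = n := by rw [hl, hr, mem_antidiagonal.1 hp]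
  rw [hf l r hsize, shapeProb, ← hsize]
  push_cast
  field_simp

theorem sum_shapeProb (n : ℕ) : ∑ u ∈ treesOfNumNodesEq n, shapeProb u = 1 := by
  induction n using Nat.strong_induction_on with
  | _ n ih =>
    cases n with
    | zero => simp [shapeProb]
    | succ n =>
      have hrec := add_one_mul_sum_shapeProb_mul_succ (n := n) (f := 1) (g := 1) (h := 1)
        fun l r _ => (mul_one 1).symm
      simp only [Pi.one_apply, mul_one] at hrec
      refine mul_left_cancel₀ (Nat.cast_add_one_ne_zero n) (hrec.trans ?_)
      rw [Finset.sum_congr rfl (g := fun _ => 1) fun p hp => ?_]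
      · simp
      · have := mem_antidiagonal.1 hp
        rw [ih p.1 (by omega), ih p.2 (by omega), mul_one]

theorem card_increasingTrees (hn : n ≠ 0) : (#(increasingTrees n) : ℝ) = n ! := by
  simpa [sum_shapeProb] using card_filter_shape_increasingTrees hn fun _ => True

theorem occurrenceProb_nonneg (n : ℕ) (t : BinaryTree Unit) : 0 ≤ occurrenceProb n t :=
  div_nonneg (Nat.cast_nonneg _) (Nat.cast_nonneg _)

theorem occurrenceProb_eq_sum_shapeProb (n : ℕ) (t : BinaryTree Unit) :
    occurrenceProb n t = ∑ u ∈ treesOfNumNodesEq n with t ∈ fringeShapes u, shapeProb u := by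
  obtain rfl | hn := eq_or_ne n 0
  · simp [occurrenceProb, increasingTrees_zero, Finset.filter_singleton]
  · have hcount := card_filter_shape_increasingTrees hn fun u => t ∈ fringeShapes u
    simp only [fringeShapes_shape] at hcount
    rw [occurrenceProb, hcount, card_increasingTrees hn, mul_div_cancel_left₀]
    positivity

theorem one_sub_occurrenceProb_eq_sum_shapeProb (n : ℕ) (t : BinaryTree Unit) :
    1 - occurrenceProb n t =
      ∑ u ∈ treesOfNumNodesEq n, shapeProb u * if t ∈ fringeShapes u then 0 else 1 := by
  simp only [mul_ite, mul_zero, mul_one]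
  rw [occurrenceProb_eq_sum_shapeProb, sub_eq_iff_eq_add', ← sum_shapeProb n, Finset.sum_filter,
    ← Finset.sum_add_distrib]
  exact Finset.sum_congr rfl fun u _ => by split_ifs <;> simp

theorem occurrenceProb_of_lt (h : n < t.numNodes) : occurrenceProb n t = 0 := by
  rw [occurrenceProb_eq_sum_shapeProb, Finset.filter_false_of_mem, Finset.sum_empty]
  intro u hu hmem
  rw [mem_treesOfNumNodesEq] at hu
  exact h.not_ge (hu ▸ numNodes_le_of_mem_fringeShapes hmem)

theorem occurrenceProb_numNodes (ht : t ≠ .nil) :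
    occurrenceProb t.numNodes t = shapeProb t := by
  rw [occurrenceProb_eq_sum_shapeProb,
    Finset.sum_eq_single_of_mem t (by simp [mem_fringeShapes_iff_eq ht le_rfl])]
  intro u hu hut
  rw [mem_filter, mem_treesOfNumNodesEq] at hu
  obtain ⟨hsize, hmem⟩ := hu
  refine absurd ((mem_fringeShapes_iff_eq ?_ hsize.le).1 hmem).symm hut
  rintro rfl
  simp at hmem

theorem sum_antidiagonal_const (n : ℕ) (c : ℝ) :
    ∑ _p ∈ antidiagonal n, c = (n + 1) * c := by
  simp

theorem add_one_mul_occurrenceProb_succ (h : t.numNodes ≤ n) :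
    (n + 1) * occurrenceProb (n + 1) t =
      ∑ p ∈ antidiagonal n, (occurrenceProb p.1 t + occurrenceProb p.2 t -
        occurrenceProb p.1 t * occurrenceProb p.2 t) := by
  have havoid : (n + 1) * (1 - occurrenceProb (n + 1) t) =
      ∑ p ∈ antidiagonal n, (1 - occurrenceProb p.1 t) * (1 - occurrenceProb p.2 t) := by
    simp only [one_sub_occurrenceProb_eq_sum_shapeProb]
    refine add_one_mul_sum_shapeProb_mul_succ fun l r hlr => ?_
    have hne : t ≠ l △ r := by
      rintro rfl
      rw [numNodes] at h
      omega
    simp only [mem_fringeShapes_node, shape_unit, hne, false_or]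
    by_cases hl : t ∈ fringeShapes l <;> by_cases hr : t ∈ fringeShapes r <;> simp [hl, hr]
  calc (n + 1) * occurrenceProb (n + 1) t
      = ∑ _p ∈ antidiagonal n, (1 : ℝ) - (n + 1) * (1 - occurrenceProb (n + 1) t) := by
        rw [sum_antidiagonal_const]; ring
    _ = _ := by
        rw [havoid, ← Finset.sum_sub_distrib]
        exact Finset.sum_congr rfl fun p _ => by ring

theorem one_sub_coeff_egfS_div_coeff_egfT (hn : n ≠ 0) (t : BinaryTree Unit) :
    1 - PowerSeries.coeff n (egfS t) / PowerSeries.coeff n egfT = occurrenceProb n t := by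
  have hcard : (#(increasingTrees n) : ℝ) ≠ 0 := by
    rw [card_increasingTrees hn]; positivity
  have hsplit : (#{τ ∈ increasingTrees n | t ∈ fringeShapes τ} : ℝ) +
      #{τ ∈ increasingTrees n | t ∉ fringeShapes τ} = #(increasingTrees n) := by
    exact_mod_cast Finset.card_filter_add_card_filter_not fun τ => t ∈ fringeShapes τ
  rw [egfS, egfT, PowerSeries.coeff_mk, PowerSeries.coeff_mk,
    div_div_div_cancel_right₀ (by positivity), occurrenceProb, eq_div_iff hcard, sub_mul,
    div_mul_cancel₀ _ hcard, one_mul, sub_eq_iff_eq_add, hsplit]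

theorem fringeShapes_subset_shapesUpTo {α : Type*} (τ : BinaryTree α) :
    fringeShapes τ ⊆ shapesUpTo τ.numNodes := fun _ ht =>
  mem_shapesUpTo.2 ⟨numNodes_pos_of_mem_fringeShapes ht, numNodes_le_of_mem_fringeShapes ht⟩

theorem expectedCompactedSize_eq_sum_occurrenceProb (n : ℕ) :
    expectedCompactedSize n = ∑ t ∈ shapesUpTo n, occurrenceProb n t := by
  have hcount : ∀ τ ∈ increasingTrees n,
      compactedSize τ = #{t ∈ shapesUpTo n | t ∈ fringeShapes τ} := by
    intro τ hτ
    rw [Finset.filter_mem_eq_inter, Finset.inter_eq_right.2, compactedSize]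
    exact numNodes_of_mem_increasingTrees hτ ▸ fringeShapes_subset_shapesUpTo τ
  simp only [expectedCompactedSize, occurrenceProb]
  rw [← Finset.sum_div]
  norm_cast
  rw [Finset.sum_congr rfl hcount]
  congr 2
  exact Finset.sum_card_bipartiteAbove_eq_sum_card_bipartiteBelow fun τ t => t ∈ fringeShapes τ

end RandomShape

section Occurrence

variable {k n : ℕ} {t : BinaryTree Unit}

/-- The expected number of fringe subtrees with `k ≥ 1` nodes in a random increasing tree with `n`
nodes, in closed form. -/
noncomputable def expectedFringeCount (k n : ℕ) : ℝ :=
  if n < k then 0 else if n = k then 1 else 2 * (n + 1) / ((k + 1) * (k + 2))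

theorem expectedFringeCount_of_lt (h : n < k) : expectedFringeCount k n = 0 := if_pos h

theorem expectedFringeCount_self (k : ℕ) : expectedFringeCount k k = 1 := by
  simp [expectedFringeCount]

theorem expectedFringeCount_of_gt (h : k < n) :
    expectedFringeCount k n = 2 * (n + 1) / ((k + 1) * (k + 2)) := by
  rw [expectedFringeCount, if_neg h.not_gt, if_neg h.ne']

theorem expectedFringeCount_le (k n : ℕ) : expectedFringeCount k n ≤ (n + 1) / (k + 1) := by
  obtain h | rfl | h := lt_trichotomy n k
  · rw [expectedFringeCount_of_lt h]
    positivity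
  · rw [expectedFringeCount_self, div_self (by positivity)]
  · rw [expectedFringeCount_of_gt h, mul_comm 2, mul_div_mul_comm]
    exact mul_le_of_le_one_right (by positivity) ((div_le_one (by positivity)).2 (by simp))

theorem le_expectedFringeCount (h : k ≤ n) :
    2 * (n + 1) / ((k + 1) * (k + 2)) ≤ expectedFringeCount k n := by
  obtain rfl | h := h.eq_or_lt
  · rw [expectedFringeCount_self, div_le_one (by positivity), mul_comm]
    gcongr
    simp
  · rw [expectedFringeCount_of_gt h]

theorem two_mul_sum_range_expectedFringeCount (h : k ≤ n) :
    2 * ∑ i ∈ range (n + 1), expectedFringeCount k i =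
      (n + 1) * expectedFringeCount k (n + 1) := by
  induction n, h using Nat.le_induction with
  | base =>
    rw [Finset.sum_range_succ, expectedFringeCount_self, expectedFringeCount_of_gt k.lt_succ_self,
      Finset.sum_eq_zero fun i hi => expectedFringeCount_of_lt (Finset.mem_range.1 hi)]
    push_cast
    field_simp
    ring
  | succ n hn ih =>
    rw [Finset.sum_range_succ, mul_add, ih, expectedFringeCount_of_gt (by omega),
      expectedFringeCount_of_gt (by omega)]
    push_cast
    field_simp
    ring

theorem sum_antidiagonal_expectedFringeCount_add (h : k ≤ n) :
    ∑ p ∈ antidiagonal n, (expectedFringeCount k p.1 + expectedFringeCount k p.2) =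
      (n + 1) * expectedFringeCount k (n + 1) := by
  have hfst : ∑ p ∈ antidiagonal n, expectedFringeCount k p.1 =
      ∑ i ∈ range (n + 1), expectedFringeCount k i :=
    Finset.Nat.sum_antidiagonal_eq_sum_range_succ (fun i _ => expectedFringeCount k i) n
  have hsnd : ∑ p ∈ antidiagonal n, expectedFringeCount k p.2 =
      ∑ p ∈ antidiagonal n, expectedFringeCount k p.1 :=
    Finset.Nat.sum_antidiagonal_swap (f := fun p => expectedFringeCount k p.1)
  rw [Finset.sum_add_distrib, hsnd, hfst, ← two_mul, two_mul_sum_range_expectedFringeCount h]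

theorem occurrenceProb_le_shapeProb_mul_expectedFringeCount (ht : t ≠ .nil) (n : ℕ) :
    occurrenceProb n t ≤ shapeProb t * expectedFringeCount t.numNodes n := by
  induction n using Nat.strong_induction_on with
  | _ n ih =>
    obtain h | rfl | h := lt_trichotomy n t.numNodes
    · rw [occurrenceProb_of_lt h, expectedFringeCount_of_lt h, mul_zero]
    · rw [occurrenceProb_numNodes ht, expectedFringeCount_self, mul_one]
    · obtain ⟨n, rfl⟩ := Nat.exists_eq_succ_of_ne_zero h.ne_bot
      have htn : t.numNodes ≤ n := Nat.le_of_lt_succ h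
      refine le_of_mul_le_mul_left ?_ (Nat.cast_add_one_pos n)
      rw [Nat.succ_eq_add_one, add_one_mul_occurrenceProb_succ htn, mul_left_comm,
        ← sum_antidiagonal_expectedFringeCount_add htn, Finset.mul_sum]
      refine Finset.sum_le_sum fun p hp => ?_
      have hp := mem_antidiagonal.1 hp
      linarith [ih p.1 (by omega), ih p.2 (by omega),
        mul_nonneg (occurrenceProb_nonneg p.1 t) (occurrenceProb_nonneg p.2 t)]

theorem occurrenceProb_le_div_mul_add_one (ht : t ≠ .nil) (n : ℕ) :
    occurrenceProb n t ≤ shapeProb t / (t.numNodes + 1) * (n + 1) :=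
  calc occurrenceProb n t ≤ shapeProb t * expectedFringeCount t.numNodes n :=
        occurrenceProb_le_shapeProb_mul_expectedFringeCount ht n
    _ ≤ shapeProb t * ((n + 1) / (t.numNodes + 1)) :=
        mul_le_mul_of_nonneg_left (expectedFringeCount_le _ _) (shapeProb_nonneg t)
    _ = shapeProb t / (t.numNodes + 1) * (n + 1) := by ring

/-- A Bonferroni inequality: the subtracted term bounds the expected number of pairs of fringe
subtrees of shape `t`. -/
theorem shapeProb_mul_expectedFringeCount_sub_le_occurrenceProb (ht : t ≠ .nil) (n : ℕ) :
    shapeProb t * expectedFringeCount t.numNodes n -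
        (shapeProb t / (t.numNodes + 1)) ^ 2 * ((n + 1) * (n + 2) / 2) ≤
      occurrenceProb n t := by
  set q := shapeProb t / (t.numNodes + 1)
  have hq0 : 0 ≤ q := div_nonneg (shapeProb_nonneg t) (by positivity)
  induction n using Nat.strong_induction_on with
  | _ n ih =>
    obtain h | rfl | h := lt_trichotomy n t.numNodes
    · rw [occurrenceProb_of_lt h, expectedFringeCount_of_lt h, mul_zero]
      exact sub_nonpos.2 (by positivity)
    · rw [occurrenceProb_numNodes ht, expectedFringeCount_self, mul_one]
      exact sub_le_self _ (by positivity)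
    · obtain ⟨n, rfl⟩ := Nat.exists_eq_succ_of_ne_zero h.ne_bot
      have htn : t.numNodes ≤ n := Nat.le_of_lt_succ h
      refine le_of_mul_le_mul_left ?_ (Nat.cast_add_one_pos n)
      rw [Nat.succ_eq_add_one, add_one_mul_occurrenceProb_succ htn, mul_sub, mul_left_comm,
        ← sum_antidiagonal_expectedFringeCount_add htn, Finset.mul_sum,
        ← sum_antidiagonal_const n, ← Finset.sum_sub_distrib]
      refine Finset.sum_le_sum fun p hp => ?_
      have hp := mem_antidiagonal.1 hp
      have hprod : occurrenceProb p.1 t * occurrenceProb p.2 t ≤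
          (q * (p.1 + 1)) * (q * (p.2 + 1)) :=
        mul_le_mul (occurrenceProb_le_div_mul_add_one ht _)
          (occurrenceProb_le_div_mul_add_one ht _) (occurrenceProb_nonneg _ _) (by positivity)
      have hpairs : ((p.1 + 1) * (p.1 + 2) / 2 + (p.2 + 1) * (p.2 + 2) / 2 +
          (p.1 + 1) * (p.2 + 1) : ℝ) = ((n + 1 : ℕ) + 1) * ((n + 1 : ℕ) + 2) / 2 := by
        rw [← hp]; push_cast; ring
      rw [← hpairs]
      linarith [ih p.1 (by omega), ih p.2 (by omega)]

theorem le_occurrenceProb (ht : t ≠ .nil) (htn : t.numNodes ≤ n)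
    (hprob : shapeProb t * (n + 2) ≤ 1) :
    shapeProb t * ((n + 1) / ((t.numNodes + 1) * (t.numNodes + 2))) ≤ occurrenceProb n t := by
  refine le_trans ?_ (shapeProb_mul_expectedFringeCount_sub_le_occurrenceProb ht n)
  have hmean := mul_le_mul_of_nonneg_left (le_expectedFringeCount htn) (shapeProb_nonneg t)
  set x := shapeProb t
  set k := t.numNodes
  have hx : 0 ≤ x := shapeProb_nonneg t
  have hden : ((k + 1) * (k + 2) : ℝ) ≤ 2 * (k + 1) ^ 2 := by
    nlinarith [k.cast_nonneg (α := ℝ)]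
  have hpairs : (x / (k + 1)) ^ 2 * ((n + 1) * (n + 2) / 2) ≤
      x * ((n + 1) / ((k + 1) * (k + 2))) :=
    calc (x / (k + 1)) ^ 2 * ((n + 1) * (n + 2) / 2)
        = x * (n + 1) / (2 * (k + 1) ^ 2) * (x * (n + 2)) := by field_simp
      _ ≤ x * (n + 1) / ((k + 1) * (k + 2)) * 1 :=
          mul_le_mul (div_le_div_of_nonneg_left (by positivity) (by positivity) hden) hprob
            (by positivity) (by positivity)
      _ = x * ((n + 1) / ((k + 1) * (k + 2))) := by ring
  have hdouble : x * (2 * (n + 1) / ((k + 1) * (k + 2))) =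
      2 * (x * ((n + 1) / ((k + 1) * (k + 2)))) := by ring
  linarith

/-- The rate `1 / 3` only has to satisfy `exp (2 / 3) ≤ 2`, where `2` is the least size of a tree
with a non-empty proper subtree. -/
theorem shapeProb_le_exp (u : BinaryTree Unit) :
    shapeProb u ≤ Real.exp ((1 - u.numNodes) / 3) := by
  induction u using BinaryTree.unitRecOn with
  | base => simp [shapeProb]
  | ind l r hl hr =>
    obtain hsize | hsize := Nat.eq_zero_or_pos (l.numNodes + r.numNodes)
    · obtain ⟨hl0, hr0⟩ := Nat.add_eq_zero_iff.1 hsize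
      obtain rfl : l = .nil := by simpa using mem_treesOfNumNodesEq.2 hl0
      obtain rfl : r = .nil := by simpa using mem_treesOfNumNodesEq.2 hr0
      simp [shapeProb]
    have hexp : Real.exp (2 / 3) ≤ 2 := by
      rw [← Real.le_log_iff_exp_le two_pos]
      linarith [Real.log_two_gt_d9]
    have htwo : (2 : ℝ) ≤ l.numNodes + r.numNodes + 1 := by exact_mod_cast Nat.succ_le_succ hsize
    rw [shapeProb, div_le_iff₀ (by positivity)]
    calc shapeProb l * shapeProb r
        ≤ Real.exp ((1 - l.numNodes) / 3) * Real.exp ((1 - r.numNodes) / 3) :=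
          mul_le_mul hl hr (shapeProb_nonneg r) (Real.exp_nonneg _)
      _ = Real.exp ((1 - (l △ r).numNodes) / 3) * Real.exp (2 / 3) := by
          rw [← Real.exp_add, ← Real.exp_add, numNodes]
          push_cast
          ring_nf
      _ ≤ Real.exp ((1 - (l △ r).numNodes) / 3) * (l.numNodes + r.numNodes + 1) := by
          gcongr
          exact hexp.trans htwo

theorem shapeProb_mul_le_one (h : 3 * Real.log (n + 2) + 1 ≤ t.numNodes) :
    shapeProb t * (n + 2) ≤ 1 :=
  calc shapeProb t * (n + 2) ≤ Real.exp (-Real.log (n + 2)) * (n + 2) := by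
        gcongr
        exact (shapeProb_le_exp t).trans (Real.exp_le_exp.2 (by linarith))
    _ = 1 := by rw [Real.exp_neg, Real.exp_log (by positivity), inv_mul_cancel₀ (by positivity)]

theorem le_sum_occurrenceProb_treesOfNumNodesEq (hkn : k ≤ n)
    (hk : 3 * Real.log (n + 2) + 1 ≤ k) :
    (n + 1) / ((k + 1) * (k + 2)) ≤ ∑ t ∈ treesOfNumNodesEq k, occurrenceProb n t := by
  have hlog : 0 ≤ Real.log (n + 2) := Real.log_nonneg (by linarith [n.cast_nonneg (α := ℝ)])
  have hsplit (c : ℝ) : c = ∑ t ∈ treesOfNumNodesEq k, shapeProb t * c := by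
    rw [← Finset.sum_mul, sum_shapeProb, one_mul]
  rw [hsplit (_ / _)]
  refine Finset.sum_le_sum fun t ht => ?_
  obtain rfl := mem_treesOfNumNodesEq.1 ht
  refine le_occurrenceProb ?_ hkn (shapeProb_mul_le_one hk)
  rintro rfl
  rw [numNodes, Nat.cast_zero] at hk
  linarith

end Occurrence

section LargeShapes

variable {n : ℕ}

theorem treesOfNumNodesEq_subset_largeShapes {k : ℕ} (hkn : k ≤ n)
    (hk : 3 * Real.log (n + 2) + 1 ≤ k) : treesOfNumNodesEq k ⊆ largeShapes n := by
  intro t ht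
  obtain rfl := mem_treesOfNumNodesEq.1 ht
  have hlog : 0 ≤ Real.log (n + 2) := Real.log_nonneg (by linarith [n.cast_nonneg (α := ℝ)])
  have hpos : 1 ≤ t.numNodes := by
    have : (1 : ℝ) ≤ t.numNodes := by linarith
    exact_mod_cast this
  have hn : (0 : ℝ) < n := by exact_mod_cast hpos.trans hkn
  have hlog_four : 1 ≤ Real.log 4 := by
    rw [show (4 : ℝ) = 2 ^ 2 by norm_num, Real.log_pow]
    push_cast
    linarith [Real.log_two_gt_d9]
  have hlogb : Real.logb 4 n ≤ Real.log (n + 2) :=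
    calc Real.logb 4 n ≤ Real.log n :=
          div_le_self (Real.log_natCast_nonneg n) hlog_four
      _ ≤ Real.log (n + 2) := Real.log_le_log hn (by linarith)
  rw [largeShapes, mem_filter, mem_shapesUpTo]
  exact ⟨⟨hpos, hkn⟩, by linarith⟩

theorem sum_Ico_inv_mul_succ {a b : ℕ} (h : a ≤ b) :
    ∑ k ∈ Finset.Ico a b, (1 : ℝ) / ((k + 1) * (k + 2)) = 1 / (a + 1) - 1 / (b + 1) := by
  rw [← neg_sub_neg, ← Finset.sum_Ico_sub (fun k : ℕ => -(1 / (k + 1) : ℝ)) h]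
  refine Finset.sum_congr rfl fun k _ => ?_
  push_cast
  field_simp
  ring

theorem le_sum_occurrenceProb_largeShapes {K : ℕ} (hKn : K ≤ n)
    (hK : 3 * Real.log (n + 2) + 1 ≤ K) :
    (n + 1) / (K + 1) - 1 ≤ ∑ t ∈ largeShapes n, occurrenceProb n t := by
  have hrange : ∀ k ∈ Finset.Ico K (n + 1), k ≤ n ∧ 3 * Real.log (n + 2) + 1 ≤ k := fun k hk =>
    have ⟨hKk, hkn⟩ := Finset.mem_Ico.1 hk
    ⟨Nat.le_of_lt_succ hkn, hK.trans (Nat.cast_le.2 hKk)⟩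
  calc ((n : ℝ) + 1) / (K + 1) - 1
      ≤ (n + 1) * (1 / (K + 1) - 1 / ((n + 1 : ℕ) + 1)) := by
        rw [mul_sub, mul_one_div, mul_one_div]
        gcongr
        exact div_le_one_of_le₀ (by simp) (by positivity)
    _ = ∑ k ∈ Finset.Ico K (n + 1), (n + 1) / ((k + 1) * (k + 2) : ℝ) := by
        simp only [← sum_Ico_inv_mul_succ (Nat.le_succ_of_le hKn), Finset.mul_sum, mul_one_div]
    _ ≤ ∑ k ∈ Finset.Ico K (n + 1), ∑ t ∈ treesOfNumNodesEq k, occurrenceProb n t :=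
        Finset.sum_le_sum fun k hk =>
          le_sum_occurrenceProb_treesOfNumNodesEq (hrange k hk).1 (hrange k hk).2
    _ = ∑ t ∈ (Finset.Ico K (n + 1)).biUnion treesOfNumNodesEq, occurrenceProb n t := by
        refine (Finset.sum_biUnion fun i _ j _ hij => Finset.disjoint_left.2 fun t hi hj => ?_).symm
        exact hij ((mem_treesOfNumNodesEq.1 hi).symm.trans (mem_treesOfNumNodesEq.1 hj))
    _ ≤ ∑ t ∈ largeShapes n, occurrenceProb n t :=
        Finset.sum_le_sum_of_subset_of_nonneg
          (Finset.biUnion_subset.2 fun k hk =>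
            treesOfNumNodesEq_subset_largeShapes (hrange k hk).1 (hrange k hk).2)
          fun t _ _ => occurrenceProb_nonneg n t

theorem log_add_two_le_two_mul_log (hn : 2 ≤ n) : Real.log (n + 2) ≤ 2 * Real.log n := by
  have hn : (2 : ℝ) ≤ n := by exact_mod_cast hn
  rw [← Real.log_rpow (by linarith), Real.rpow_two]
  exact Real.log_le_log (by linarith) (by nlinarith)

theorem div_log_le_sum_occurrenceProb_largeShapes :
    ∀ᶠ n : ℕ in atTop, 1 / 14 * (n / Real.log n) ≤ ∑ t ∈ largeShapes n, occurrenceProb n t := by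
  have hlog_large : ∀ᶠ n : ℕ in atTop, 3 ≤ Real.log n :=
    (Real.tendsto_log_atTop.comp tendsto_natCast_atTop_atTop).eventually_ge_atTop 3
  have hlog_small : ∀ᶠ n : ℕ in atTop, Real.log n ≤ 1 / 14 * n := by
    have hlittle := Real.isLittleO_log_id_atTop.comp_tendsto
      (tendsto_natCast_atTop_atTop (R := ℝ))
    filter_upwards [hlittle.bound (show (0 : ℝ) < 1 / 14 by norm_num)] with n hn
    simpa using (le_abs_self _).trans hn
  filter_upwards [hlog_large, hlog_small, eventually_ge_atTop 2] with n hlarge hsmall hn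
  have : (2 : ℝ) ≤ n := by exact_mod_cast hn
  have hlog := log_add_two_le_two_mul_log hn
  set K := ⌈3 * Real.log (n + 2) + 1⌉₊
  have hlogn : 0 ≤ Real.log (n + 2) := Real.log_nonneg (by linarith)
  have hKlt : (K : ℝ) < 3 * Real.log (n + 2) + 1 + 1 := Nat.ceil_lt_add_one (by positivity)
  have hKle : (K : ℝ) + 1 ≤ 7 * Real.log n := by linarith
  have hKn : K ≤ n := by
    have : (K : ℝ) ≤ n := by linarith
    exact_mod_cast this
  calc 1 / 14 * (n / Real.log n)
      ≤ n / (7 * Real.log n) - 1 := by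
        have : 1 ≤ 1 / 14 * (n / Real.log n) := by
          rw [← mul_div_assoc, one_le_div (by linarith)]
          exact hsmall
        have : n / (7 * Real.log n) = 1 / 7 * (n / Real.log n) := by ring
        linarith
    _ ≤ (n + 1) / (K + 1) - 1 := by
        gcongr
        linarith
    _ ≤ ∑ t ∈ largeShapes n, occurrenceProb n t :=
        le_sum_occurrenceProb_largeShapes hKn (Nat.le_ceil _)

theorem sqrt_le_two_mul_div_log (hn : 2 ≤ n) : √n ≤ 2 * (n / Real.log n) := by
  have hlog : 0 < Real.log n := Real.log_pos (by exact_mod_cast hn)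
  rw [← mul_div_assoc, le_div_iff₀ hlog]
  calc √n * Real.log n = √n * (2 * Real.log √n) := by
        rw [Real.log_sqrt n.cast_nonneg, mul_div_cancel₀ _ two_ne_zero]
    _ ≤ √n * (2 * √n) := by
        gcongr
        exact Real.log_le_self (Real.sqrt_nonneg _)
    _ = 2 * n := by rw [mul_left_comm, Real.mul_self_sqrt n.cast_nonneg]

theorem exists_mul_sqrt_le_of_exists_mul_div_log_le {f : ℕ → ℝ}
    (h : ∃ c : ℝ, 0 < c ∧ ∀ᶠ n : ℕ in atTop, c * (n / Real.log n) ≤ f n) :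
    ∃ c : ℝ, 0 < c ∧ ∀ᶠ n : ℕ in atTop, c * √n ≤ f n := by
  obtain ⟨c, hc, hf⟩ := h
  refine ⟨c / 2, half_pos hc, ?_⟩
  filter_upwards [hf, eventually_ge_atTop 2] with n hfn hn
  calc c / 2 * √n ≤ c / 2 * (2 * (n / Real.log n)) := by
        gcongr
        exact sqrt_le_two_mul_div_log hn
    _ = c * (n / Real.log n) := by ring
    _ ≤ f n := hfn

end LargeShapes

end IncBinTree

theorem mainTheorem4_general :
    (∃ c : ℝ, 0 < c ∧ ∀ᶠ n : ℕ in atTop,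
      c * (n / Real.log n) ≤ ∑ t ∈ IncBinTree.largeShapes n,
        (1 - PowerSeries.coeff n (IncBinTree.egfS t) / PowerSeries.coeff n IncBinTree.egfT)) ∧
    (∃ c : ℝ, 0 < c ∧ ∀ᶠ n : ℕ in atTop,
      c * (n / Real.log n) ≤ ∑ t ∈ IncBinTree.largeShapes n, IncBinTree.occurrenceProb n t) ∧
    (∃ c : ℝ, 0 < c ∧ ∀ᶠ n : ℕ in atTop,
      c * (n / Real.log n) ≤ IncBinTree.expectedCompactedSize n) := by
  have hbound := IncBinTree.div_log_le_sum_occurrenceProb_largeShapes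
  refine ⟨⟨1 / 14, by norm_num, ?_⟩, ⟨1 / 14, by norm_num, hbound⟩, ⟨1 / 14, by norm_num, ?_⟩⟩
  · filter_upwards [hbound, eventually_ne_atTop 0] with n hle hn
    simpa only [IncBinTree.one_sub_coeff_egfS_div_coeff_egfT hn] using hle
  · filter_upwards [hbound] with n hle
    rw [IncBinTree.expectedCompactedSize_eq_sum_occurrenceProb]
    exact hle.trans (Finset.sum_le_sum_of_subset_of_nonneg (Finset.filter_subset _ _)
      fun t _ _ => IncBinTree.occurrenceProb_nonneg n t)

theorem mainTheorem4 :
    (∃ c : ℝ, 0 < c ∧ ∀ᶠ n : ℕ in atTop,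
      c * Real.sqrt (n : ℝ) ≤ ∑ t ∈ IncBinTree.largeShapes n,
        (1 - PowerSeries.coeff n (IncBinTree.egfS t) / PowerSeries.coeff n IncBinTree.egfT)) ∧
    (∃ c : ℝ, 0 < c ∧ ∀ᶠ n : ℕ in atTop,
      c * Real.sqrt (n : ℝ) ≤ ∑ t ∈ IncBinTree.largeShapes n, IncBinTree.occurrenceProb n t) ∧
    (∃ c : ℝ, 0 < c ∧ ∀ᶠ n : ℕ in atTop,
      c * Real.sqrt (n : ℝ) ≤ IncBinTree.expectedCompactedSize n) := by
  have weaken {f : ℕ → ℝ} := IncBinTree.exists_mul_sqrt_le_of_exists_mul_div_log_le (f := f)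
  exact mainTheorem4_general.imp weaken (.imp weaken weaken)
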